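/- Let $0<k<d$ and let $f\in R=\mathbb{C}[x_0,\dots,x_n]$ be a homogeneous polynomial of degree $d$ such that $X=V(f)\subset\mathbb{P}^n$ is not a cone, i.e. no invertible linear change of coordinates turns $f$ into a polynomial in $x_1,\dots,x_n$ only. Let $Q=\mathbb{C}[X_0,\dots,X_n]$ act on $R$ by $X_i=\partial/\partial x_i$, let $\operatorname{Ann}(f)=\{\alpha\in Q:\alpha(f)=0\}$, and let $A=Q/\operatorname{Ann}(f)=\bigoplus_i A_i$ be graded by degree. Choose bases $(\alpha_1,\dots,\alpha_{n+1})$ of $A_1$ and $(\beta_1,\dots,\beta_{a_k})$ of $A_k$, and let $\operatorname{Hess}^{(1,k)}_f=[\alpha_i\beta_j(f)]$ be the mixed Hessian, a matrix of polynomials whose rank is taken over the field $\mathbb{C}(x_0,\dots,x_n)$. Let $\tilde Z_k\subseteq\mathbb{P}^{\binom{n+k}{k}-1}$ be the Zariski closure of the image of the $k$-th polar map $\Phi^k:\mathbb{P}^n\dashrightarrow\mathbb{P}^{\binom{n+k}{k}-1}$ given by all $k$-th order partial derivatives of $f$, and let $Z_k\subseteq\mathbb{P}^{a_k-1}$ be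 the Zariski closure of the image of the relative $k$-th polar map $\varphi^k:\mathbb{P}^n\dashrightarrow\mathbb{P}^{a_k-1}$, $p\mapsto(\beta_1(f)(p):\dots:\beta_{a_k}(f)(p))$. Then $$\dim Z_k=\dim\tilde Z_k=\operatorname{rank}\bigl(\operatorname{Hess}^{(1,k)}_f\bigr)-1 .$$ Moreover, the following conditions are equivalent: (i) $\varphi^k$ is degenerate, that is, $\dim Z_k<n$; (ii) $\operatorname{rank}\bigl(\operatorname{Hess}^{(1,k)}_f\bigr)<n+1$; (iii) for no $L\in A_1$ does the multiplication map $\bullet L^{d-k-1}:A_1\to A_{d-k}$ have maximal rank, i.e. rank equal to $\min(\dim A_1,\dim A_{d-k})$. -/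

import Mathlib

open MvPolynomial

namespace HigherPolar

noncomputable section

/-! ### Macaulay–Matlis duality: polynomials as differential operators -/

/-- The partial derivative `∂/∂x_i` as a `ℂ`-linear endomorphism of `ℂ[x_σ]`. -/
def partialEnd {σ : Type*} (i : σ) : Module.End ℂ (MvPolynomial σ ℂ) :=
  (pderiv i : Derivation ℂ (MvPolynomial σ ℂ) (MvPolynomial σ ℂ)).toLinearMap

theorem partialEnd_apply {σ : Type*} (i : σ) (g : MvPolynomial σ ℂ) :
    partialEnd i g = pderiv i g := rfl

theorem partialEnd_comm {σ : Type*} (i j : σ) :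
    (partialEnd i : Module.End ℂ (MvPolynomial σ ℂ)) * partialEnd j
      = partialEnd j * partialEnd i := by
  classical
  have h : ⁅(pderiv i : Derivation ℂ (MvPolynomial σ ℂ) (MvPolynomial σ ℂ)),
      (pderiv j : Derivation ℂ (MvPolynomial σ ℂ) (MvPolynomial σ ℂ))⁆ = 0 := by
    apply derivation_ext
    intro l
    by_cases h1 : l = i <;> by_cases h2 : l = j <;>
      simp [Derivation.commutator_apply, pderiv_X, Pi.single_apply, h1, h2] <;>
      split_ifs <;> simp
  refine LinearMap.ext fun g => ?_
  have hg := congrArg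
    (fun D : Derivation ℂ (MvPolynomial σ ℂ) (MvPolynomial σ ℂ) => D g) h
  simp only [Derivation.commutator_apply, Derivation.coe_zero, Pi.zero_apply] at hg
  exact sub_eq_zero.mp hg

/-- The (commutative) algebra of differential operators with constant coefficients. -/
abbrev DiffOps (σ : Type*) : Subalgebra ℂ (Module.End ℂ (MvPolynomial σ ℂ)) :=
  Algebra.adjoin ℂ (Set.range partialEnd)

instance instCommRingDiffOps (σ : Type*) : CommRing (DiffOps σ) :=
  { (inferInstance : Ring (DiffOps σ)) with
    mul_comm := by
      have := Algebra.isMulCommutative_adjoin ℂ (s := Set.range (partialEnd (σ := σ))) (by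
        rintro _ ⟨i, rfl⟩ _ ⟨j, rfl⟩
        exact partialEnd_comm i j)
      exact this.is_comm.comm }

/-- The action of `Q = ℂ[X_σ]` on `R = ℂ[x_σ]` by differential operators: the algebra
homomorphism with `X i ↦ ∂/∂x_i`. -/
def diffOp {σ : Type*} : MvPolynomial σ ℂ →ₐ[ℂ] Module.End ℂ (MvPolynomial σ ℂ) :=
  (DiffOps σ).val.comp
    (aeval fun i => (⟨partialEnd i, Algebra.subset_adjoin ⟨i, rfl⟩⟩ : DiffOps σ))

theorem diffOp_X {σ : Type*} (i : σ) (g : MvPolynomial σ ℂ) :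
    diffOp (X i) g = pderiv i g := by
  simp [diffOp, partialEnd_apply]

/-- The annihilator ideal `Ann(f) = {α ∈ Q | α(f) = 0}`. -/
def Ann {σ : Type*} (f : MvPolynomial σ ℂ) : Ideal (MvPolynomial σ ℂ) where
  carrier := {α | diffOp α f = 0}
  add_mem' := by
    intro a b ha hb
    simp only [Set.mem_ofPred_eq] at ha hb ⊢
    simp [ha, hb]
  zero_mem' := by simp
  smul_mem' := by
    intro c a ha
    simp only [Set.mem_ofPred_eq] at ha ⊢
    simp [ha]

theorem mem_Ann {σ : Type*} (f α : MvPolynomial σ ℂ) : α ∈ Ann f ↔ diffOp α f = 0 := Iff.rfl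

/-- The algebra `A(f) = Q / Ann(f)`. -/
abbrev A {σ : Type*} (f : MvPolynomial σ ℂ) : Type _ := MvPolynomial σ ℂ ⧸ Ann f

/-- The graded piece `A(f)_k`, the image of `Q_k` in `A(f)`. -/
def gradedPiece {σ : Type*} (f : MvPolynomial σ ℂ) (k : ℕ) : Submodule ℂ (A f) :=
  (homogeneousSubmodule σ ℂ k).map (Ideal.Quotient.mkₐ ℂ (Ann f)).toLinearMap

/-- For a class `a ∈ A(f)` represented by `α ∈ Q`, the polynomial `α(f)`. -/
def act {σ : Type*} (f : MvPolynomial σ ℂ) : A f →ₗ[ℂ] MvPolynomial σ ℂ :=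
  ((Ann f).restrictScalars ℂ).liftQ (diffOp.toLinearMap.flip f) (fun _ hα => hα) ∘ₗ
    (Submodule.Quotient.restrictScalarsEquiv ℂ (Ann f)).symm.toLinearMap

theorem act_mk {σ : Type*} (f α : MvPolynomial σ ℂ) :
    act f (Ideal.Quotient.mk (Ann f) α) = diffOp α f := rfl

/-- The mixed Hessian `Hess_f^{(k,l)} = [α_i β_j (f)]` with respect to bases `(α_i)` of `A(f)_k`
and `(β_j)` of `A(f)_l`; its entries are polynomials. -/
def mixedHessian {σ ι κ : Type*} (f : MvPolynomial σ ℂ) {k l : ℕ}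
    (a : Module.Basis ι ℂ (gradedPiece f k)) (b : Module.Basis κ ℂ (gradedPiece f l)) :
    Matrix ι κ (MvPolynomial σ ℂ) :=
  Matrix.of fun i j => act f ((a i : A f) * (b j : A f))

/-- The rank of a matrix of polynomials, i.e. its rank over the field of rational functions. -/
def genericRank {σ ι κ : Type*} [Fintype κ] (M : Matrix ι κ (MvPolynomial σ ℂ)) : ℕ :=
  (M.map (algebraMap (MvPolynomial σ ℂ) (FractionRing (MvPolynomial σ ℂ)))).rank

/-! ### Multiplication by powers of linear forms -/

theorem pow_mul_mem_gradedPiece {σ : Type*} (f : MvPolynomial σ ℂ) {i j : ℕ} (h : i ≤ j)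
    {L x : A f} (hL : L ∈ gradedPiece f 1) (hx : x ∈ gradedPiece f i) :
    L ^ (j - i) * x ∈ gradedPiece f j := by
  obtain ⟨l, hl, rfl⟩ := hL
  obtain ⟨y, hy, rfl⟩ := hx
  refine ⟨l ^ (j - i) * y, ?_, by simp⟩
  have h1 : (l ^ (j - i) * y).IsHomogeneous (1 * (j - i) + i) :=
    IsHomogeneous.mul (IsHomogeneous.pow hl _) hy
  rwa [one_mul, Nat.sub_add_cancel h] at h1

/-- The multiplication map `•L^{j-i} : A(f)_i → A(f)_j` for `L ∈ A(f)_1` and `i ≤ j`. -/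
def mulPow {σ : Type*} (f : MvPolynomial σ ℂ) {i j : ℕ} (h : i ≤ j) (L : gradedPiece f 1) :
    gradedPiece f i →ₗ[ℂ] gradedPiece f j :=
  (LinearMap.mulLeft ℂ ((L : A f) ^ (j - i))).restrict
    fun _ hx => pow_mul_mem_gradedPiece f h L.2 hx

/-- A linear map of finite-dimensional spaces has maximal rank if its rank is the minimum
of the dimensions of source and target. -/
def HasMaximalRank {V W : Type*} [AddCommGroup V] [Module ℂ V] [AddCommGroup W] [Module ℂ W]
    (g : V →ₗ[ℂ] W) : Prop :=
  Module.finrank ℂ (LinearMap.range g) = min (Module.finrank ℂ V) (Module.finrank ℂ W)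

/-! ### Projective space with its Zariski topology -/

/-- The projective space of lines in `ℂ^ι`, with homogeneous coordinates indexed by `ι`. -/
abbrev Proj (ι : Type*) : Type _ := Projectivization ℂ (ι → ℂ)

/-- The common zeros in projective space of a set of (homogeneous) polynomials. -/
def zeroLocus {ι : Type*} (S : Set (MvPolynomial ι ℂ)) : Set (Proj ι) :=
  {p | ∀ F ∈ S, eval p.rep F = 0}

theorem eval_smul {ι : Type*} {F : MvPolynomial ι ℂ} {m : ℕ} (hF : F.IsHomogeneous m)
    (c : ℂ) (v : ι → ℂ) : eval (c • v) F = c ^ m * eval v F := by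
  simp only [eval_eq, Finset.mul_sum]
  refine Finset.sum_congr rfl fun s hs => ?_
  have hd : ∑ i ∈ s.support, s i = m := by
    have := hF (mem_support_iff.mp hs)
    rw [Finsupp.weight_apply, Finsupp.sum] at this
    simpa using this
  simp only [Pi.smul_apply, smul_eq_mul, mul_pow, Finset.prod_mul_distrib,
    Finset.prod_pow_eq_pow_sum, hd]
  ring

/-- Vanishing of a homogeneous polynomial may be tested on any homogeneous coordinates. -/
theorem mk_mem_zeroLocus {ι : Type*} {S : Set (MvPolynomial ι ℂ)}
    (hS : ∀ F ∈ S, ∃ m, F.IsHomogeneous m) (v : ι → ℂ) (hv : v ≠ 0) :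
    Projectivization.mk ℂ v hv ∈ zeroLocus S ↔ ∀ F ∈ S, eval v F = 0 := by
  obtain ⟨a, ha⟩ := Projectivization.exists_smul_eq_mk_rep ℂ v hv
  refine forall₂_congr fun F hF => ?_
  obtain ⟨m, hm⟩ := hS F hF
  rw [← ha, Units.smul_def, eval_smul hm]
  simp

/-- The Zariski topology on projective space: the closed sets are the zero loci of sets of
homogeneous polynomials. -/
instance zariskiTopology (ι : Type*) : TopologicalSpace (Proj ι) :=
  TopologicalSpace.ofClosed
    {Z | ∃ S : Set (MvPolynomial ι ℂ), (∀ F ∈ S, ∃ m, F.IsHomogeneous m) ∧ Z = zeroLocus S}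
    ⟨{1}, by
      rintro F rfl
      exact ⟨0, isHomogeneous_one _ _⟩, by
      ext p
      simp [zeroLocus]⟩
    (by
      intro T hT
      have hT' : ∀ Z : Set (Proj ι), ∃ S : Set (MvPolynomial ι ℂ), Z ∈ T →
          (∀ F ∈ S, ∃ m, F.IsHomogeneous m) ∧ Z = zeroLocus S := by
        intro Z
        by_cases h : Z ∈ T
        · obtain ⟨S, hS⟩ := hT h
          exact ⟨S, fun _ => hS⟩
        · exact ⟨∅, fun h' => absurd h' h⟩
      choose S hSZ using hT'
      have hS := fun Z hZT => (hSZ Z hZT).1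
      have hZ := fun Z hZT => (hSZ Z hZT).2
      refine ⟨⋃ Z ∈ T, S Z, ?_, ?_⟩
      · intro F hF
        simp only [Set.mem_iUnion] at hF
        obtain ⟨Z, hZT, hF⟩ := hF
        exact hS Z hZT F hF
      · ext p
        simp only [Set.mem_sInter, zeroLocus, Set.mem_iUnion, Set.mem_ofPred_eq]
        constructor
        · rintro h F ⟨Z, hZT, hF⟩
          have := h Z hZT
          rw [hZ Z hZT] at this
          exact this F hF
        · intro h Z hZT
          rw [hZ Z hZT]
          exact fun F hF => h F ⟨Z, hZT, hF⟩)
    (by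
      rintro _ ⟨S, hS, rfl⟩ _ ⟨T, hT, rfl⟩
      refine ⟨{H | ∃ F ∈ S, ∃ G ∈ T, H = F * G}, ?_, ?_⟩
      · rintro _ ⟨F, hF, G, hG, rfl⟩
        obtain ⟨a, ha⟩ := hS F hF
        obtain ⟨b, hb⟩ := hT G hG
        exact ⟨a + b, ha.mul hb⟩
      · ext p
        simp only [zeroLocus, Set.mem_union, Set.mem_ofPred_eq]
        constructor
        · rintro (h | h) _ ⟨F, hF, G, hG, rfl⟩
          · simp [h F hF]
          · simp [h G hG]
        · intro h
          by_contra! hc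
          obtain ⟨⟨F, hF, hF0⟩, G, hG, hG0⟩ := hc
          have := h _ ⟨F, hF, G, hG, rfl⟩
          simp [hF0, hG0] at this)

theorem isClosed_iff {ι : Type*} (Z : Set (Proj ι)) :
    IsClosed Z ↔
      ∃ S : Set (MvPolynomial ι ℂ), (∀ F ∈ S, ∃ m, F.IsHomogeneous m) ∧ Z = zeroLocus S := by
  rw [← isOpen_compl_iff]
  change Zᶜᶜ ∈ _ ↔ _
  rw [compl_compl]
  rfl

/-! ### Rational maps and polar images -/

/-- The rational map of projective spaces `p ↦ (F_j(p))_j` given by a family of polynomials,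
as a partial function, defined where the `F_j` do not all vanish. It is meant for families of
homogeneous polynomials of one common degree. -/
def ratMap {σ ι : Type*} (F : ι → MvPolynomial σ ℂ) : Proj σ →. Proj ι :=
  fun p => ⟨(fun j => eval p.rep (F j)) ≠ 0, fun h => Projectivization.mk ℂ _ h⟩

/-- For forms of one common degree the rational map may be computed in any homogeneous
coordinates of the point. -/
theorem mem_ratMap_mk {σ ι : Type*} {F : ι → MvPolynomial σ ℂ} {m : ℕ}
    (hF : ∀ j, (F j).IsHomogeneous m) (v : σ → ℂ) (hv : v ≠ 0) (q : Proj ι) :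
    q ∈ ratMap F (Projectivization.mk ℂ v hv) ↔
      ∃ h : (fun j => eval v (F j)) ≠ 0, q = Projectivization.mk ℂ _ h := by
  obtain ⟨a, ha⟩ := Projectivization.exists_smul_eq_mk_rep ℂ v hv
  have key : (fun j => eval (Projectivization.mk ℂ v hv).rep (F j))
      = (a ^ m) • fun j => eval v (F j) := by
    funext j
    rw [← ha, Units.smul_def, eval_smul (hF j)]
    simp [Units.smul_def]
  have hne : (fun j => eval (Projectivization.mk ℂ v hv).rep (F j)) ≠ 0 ↔
      (fun j => eval v (F j)) ≠ 0 := by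
    rw [key, ne_eq, smul_eq_zero_iff_eq]
  constructor
  · rintro ⟨h, rfl⟩
    refine ⟨hne.mp h, ?_⟩
    exact (Projectivization.mk_eq_mk_iff ℂ _ _ _ _).mpr ⟨a ^ m, key.symm⟩
  · rintro ⟨h, rfl⟩
    refine ⟨hne.mpr h, ?_⟩
    exact (Projectivization.mk_eq_mk_iff ℂ _ _ _ _).mpr ⟨a ^ m, key.symm⟩

/-- The `k`-th polar map `Φ^k`, given by all the `k`-th order partial derivatives of `f`. They are
indexed by the unordered `k`-tuples of variables; there are `(n+k).choose k` of them if there are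
`n+1` variables. -/
def polarMap {σ : Type*} (f : MvPolynomial σ ℂ) (k : ℕ) : Proj σ →. Proj (Sym σ k) :=
  ratMap fun s => diffOp ((s : Multiset σ).map X).prod f

/-- The relative `k`-th polar map `φ^k = (α_1(f) : ⋯ : α_{a_k}(f))`, for a basis `(α_j)`
of `A(f)_k`. -/
def relPolarMap {σ κ : Type*} (f : MvPolynomial σ ℂ) {k : ℕ}
    (b : Module.Basis κ ℂ (gradedPiece f k)) : Proj σ →. Proj κ :=
  ratMap fun j => act f (b j : A f)

/-- The `k`-th polar image `Z̃_k`, the Zariski closure of the image of `Φ^k`. -/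
def polarImage {σ : Type*} (f : MvPolynomial σ ℂ) (k : ℕ) : Set (Proj (Sym σ k)) :=
  closure (polarMap f k).ran

/-- The relative `k`-th polar image `Z_k`, the Zariski closure of the image of `φ^k`. -/
def relPolarImage {σ κ : Type*} (f : MvPolynomial σ ℂ) {k : ℕ}
    (b : Module.Basis κ ℂ (gradedPiece f k)) : Set (Proj κ) :=
  closure (relPolarMap f b).ran

/-- `V(f) ⊆ ℙ^n` is a cone: after an invertible linear change of coordinates, `f` does not
involve the variable `x_0`. -/
def IsCone {n : ℕ} (f : MvPolynomial (Fin (n + 1)) ℂ) : Prop :=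
  ∃ M : GL (Fin (n + 1)) ℂ,
    (0 : Fin (n + 1)) ∉ (bind₁ (fun i => ∑ j, C (M.1 i j) * X j) f).vars

end

end HigherPolar

/-!
Let `F` be a family of forms of one common positive degree. The homogeneous coordinate ring of the
closure of the image of `F` is `ℂ[F]`, whose transcendence degree is the rank of the Jacobian matrix
of `F`, because in characteristic zero derivations extend uniquely along algebraic extensions. This
rank, minus one, is the dimension of the closure: it bounds the length of chains of irreducible
closed subsets since the transcendence degree drops along proper inclusions, and it is attained by
the images of a flag of linear subspaces through a point where the Jacobian matrix has maximal rank.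

The Jacobian rank depends only on the span of `F`. Both polar maps are given by families spanning
the forms `β(f)` with `β ∈ A_k`, and the mixed Hessian is a Jacobian matrix of such a family.

If `L = ∑ v_i X_i` and `g` is a form of degree `m`, then `L ^ m` sends `g` to `m! g(v)`. So, by
Macaulay duality between `A_{d-k}` and `A_k`, the map `•L^{d-k-1} : A_1 → A_{d-k}` has the same rank
as the mixed Hessian evaluated at `v`, which for general `v` is the generic rank.
-/

namespace HigherPolar

section Derivation

variable {k R K M : Type*} [Field k] [CharZero k] [CommRing R] [Algebra k R] [Field K]
  [Algebra R K] [FaithfulSMul R K] [AddCommGroup M] [Module R M]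

theorem derivation_eq_zero_of_isAlgebraic {S : Type*} [CommRing S] [IsDomain S] [CharZero S]
    [Algebra S R] [FaithfulSMul S R] [IsDomain R] [Module S M] [Module.IsTorsionFree R M]
    (D : Derivation S R M) {x : R} (hx : IsAlgebraic S x) : D x = 0 := by
  obtain ⟨p, hp, hpx⟩ := hx
  induction hn : p.natDegree using Nat.strong_induction_on generalizing p with
  | _ n ih =>
    subst hn
    have hdeg : p.natDegree ≠ 0 := fun h => hp <| by
      rw [Polynomial.eq_C_of_natDegree_eq_zero h, Polynomial.aeval_C,
        FaithfulSMul.algebraMap_eq_zero_iff] at hpx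
      rw [Polynomial.eq_C_of_natDegree_eq_zero h, hpx, Polynomial.C_0]
    have hDp : Polynomial.aeval x (Polynomial.derivative p) • D x = 0 := by
      rw [← D.map_aeval, hpx, map_zero]
    rcases smul_eq_zero.mp hDp with hp' | hDx
    · exact ih _ (Polynomial.natDegree_derivative_lt hdeg) _
        (fun h => hdeg (Polynomial.derivative_eq_zero.mp h)) hp' rfl
    · exact hDx

theorem derivation_mem_span_image [Module k M] [Module K M] [IsScalarTower R K M]
    (D : Derivation k R M) (s : Set R) [Algebra.IsAlgebraic (Algebra.adjoin k s) R] (x : R) :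
    D x ∈ Submodule.span K (D '' s) := by
  have : IsDomain R := (FaithfulSMul.algebraMap_injective R K).isDomain
  have : CharZero (Algebra.adjoin k s) :=
    charZero_of_injective_algebraMap (algebraMap k _).injective
  set V := Submodule.span K (D '' s)
  have hV : ∀ a ∈ Algebra.adjoin k s, D a ∈ V := by
    intro a ha
    induction ha using Algebra.adjoin_induction with
    | mem a ha => exact Submodule.subset_span ⟨a, ha, rfl⟩
    | algebraMap r => simp
    | add a b _ _ ha hb => rw [map_add]; exact add_mem ha hb
    | mul a b _ _ ha hb =>
      rw [D.leibniz]
      exact add_mem (V.smul_of_tower_mem a hb) (V.smul_of_tower_mem b ha)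
  have : Module.IsTorsionFree R (M ⧸ V) := .trans_faithfulSMul R K _
  let q : M →ₗ[R] M ⧸ V := V.mkQ.restrictScalars R
  have hq : ∀ a, q (D a) = 0 ↔ D a ∈ V := fun a => Submodule.Quotient.mk_eq_zero V
  have hqS : ∀ a : Algebra.adjoin k s, q (D (algebraMap _ R a)) = 0 :=
    fun a => (hq _).mpr (hV _ a.2)
  let D' : Derivation (Algebra.adjoin k s) R (M ⧸ V) := .mk'
    { toFun a := q (D a)
      map_add' a b := by rw [map_add, map_add]
      map_smul' a b := by
        rw [Algebra.smul_def, D.leibniz, map_add, map_smul, map_smul, hqS a, smul_zero, add_zero]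
        rfl }
    fun a b => by simp
  have hD' : D' x = 0 :=
    derivation_eq_zero_of_isAlgebraic D' (Algebra.IsAlgebraic.isAlgebraic x)
  exact (hq x).mp hD'

end Derivation

universe u v in
theorem injective_of_surjective_of_lift_trdeg_le {k : Type*} {A : Type u} {B : Type v} [Field k]
    [CommRing A] [IsDomain A] [Algebra k A] [CommRing B] [IsDomain B] [Algebra k B] (φ : A →ₐ[k] B)
    (hφ : Function.Surjective φ) (hA : Algebra.trdeg k A < Cardinal.aleph0)
    (h : Cardinal.lift.{v} (Algebra.trdeg k A) ≤ Cardinal.lift.{u} (Algebra.trdeg k B)) :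
    Function.Injective φ := by
  obtain ⟨ι, y, hy⟩ := exists_isTranscendenceBasis' k B
  choose x hx using fun i => hφ (y i)
  have hφx : φ ∘ x = y := funext hx
  have hind : AlgebraicIndependent k x := .of_comp φ (hφx ▸ hy.1)
  have hbasis : IsTranscendenceBasis k x :=
    hind.isTranscendenceBasis_of_lift_trdeg_le hA (h.trans_eq (by rw [hy.cardinalMk_eq_trdeg]))
  rw [injective_iff_map_eq_zero]
  by_contra!
  obtain ⟨a, hφa, ha⟩ := this
  obtain ⟨r, hr, c, hc⟩ := (hbasis.isAlgebraic.isAlgebraic a).exists_nonzero_dvd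
    (mem_nonZeroDivisors_of_ne_zero ha)
  obtain ⟨p, hp⟩ : ∃ p : MvPolynomial ι k, aeval x p = (r : A) := by
    rw [← AlgHom.mem_range, ← Algebra.adjoin_range_eq_range_aeval]
    exact r.2
  have hp0 : aeval y p = 0 := by
    have hra : (r : A) = a * c := hc
    rw [← hφx, Function.comp_def, ← comp_aeval_apply, hp, hra, map_mul, hφa, zero_mul]
  apply hr
  ext
  rw [← hp, hy.1.eq_zero_of_aeval_eq_zero p hp0, map_zero]
  rfl

noncomputable section

section Gradient

variable {σ k : Type*} [Field k]

/-- The gradient of a polynomial, as a vector of rational functions. -/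
def grad : Derivation k (MvPolynomial σ k) (σ → FractionRing (MvPolynomial σ k)) := by
  classical
  exact mkDerivation k fun l => Pi.single l 1

theorem grad_X [DecidableEq σ] (l : σ) : grad (X l : MvPolynomial σ k) = Pi.single l 1 := by
  rw [grad, mkDerivation_X]
  congr!

theorem grad_apply (g : MvPolynomial σ k) (l : σ) :
    grad g l = algebraMap _ (FractionRing (MvPolynomial σ k)) (pderiv l g) := by
  classical
  induction g using MvPolynomial.induction_on with
  | C a => rw [← algebraMap_eq, Derivation.map_algebraMap, Derivation.map_algebraMap]; simp
  | add p q hp hq => simp [hp, hq]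
  | mul_X p i hp =>
    rw [Derivation.leibniz, Derivation.leibniz, grad_X, Pi.add_apply, Pi.smul_apply, Pi.smul_apply,
      hp, map_add, smul_eq_mul, smul_eq_mul, map_mul, map_mul, Algebra.smul_def, Algebra.smul_def,
      pderiv_X]
    by_cases h : l = i
    · subst h; simp
    · simp [h, Ne.symm h]

/-- The rank of the Jacobian matrix of a family of polynomials over the field of rational
functions. -/
def jacRank {ι : Type*} (F : ι → MvPolynomial σ k) : ℕ :=
  Module.finrank (FractionRing (MvPolynomial σ k))
    (Submodule.span (FractionRing (MvPolynomial σ k)) (Set.range fun j => grad (F j)))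

local notation "K" => FractionRing (MvPolynomial σ k)

theorem linearIndependent_grad [CharZero k] [Finite σ] {ι : Type*} {x : ι → MvPolynomial σ k}
    (hx : AlgebraicIndependent k x) : LinearIndependent K fun i => grad (x i) := by
  classical
  have := Fintype.ofFinite σ
  obtain ⟨t, hxt, ht⟩ := exists_isTranscendenceBasis_superset hx.to_subtype_range
  suffices LinearIndependent K fun y : t => grad (y : MvPolynomial σ k) from
    this.comp (fun i => ⟨x i, hxt ⟨i, rfl⟩⟩) fun i j h => hx.injective (congrArg Subtype.val h)
  have hcard : Cardinal.mk t = Cardinal.lift (Cardinal.mk σ) := by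
    rw [ht.cardinalMk_eq_trdeg, MvPolynomial.trdeg_of_isDomain]
  have : Finite t := by
    rw [← Cardinal.lt_aleph0_iff_finite, hcard, Cardinal.lift_lt_aleph0]
    exact Cardinal.lt_aleph0_of_finite σ
  have := Fintype.ofFinite t
  have halg : Algebra.IsAlgebraic (Algebra.adjoin k t) (MvPolynomial σ k) := by
    have := ht.isAlgebraic
    rwa [Subtype.range_coe] at this
  refine linearIndependent_of_top_le_span_of_card_eq_finrank ?_ ?_
  · rw [← (Pi.basisFun K σ).span_eq, Submodule.span_le]
    rintro _ ⟨l, rfl⟩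
    rw [Pi.basisFun_apply, ← grad_X, ← Set.image_eq_range]
    exact derivation_mem_span_image grad t (X l)
  · rw [Module.finrank_pi, ← Nat.card_eq_fintype_card, ← Nat.card_eq_fintype_card, Nat.card,
      Nat.card, hcard, Cardinal.toNat_lift]

theorem trdeg_adjoin_eq_jacRank [CharZero k] [Finite σ] {ι : Type*} (F : ι → MvPolynomial σ k) :
    Algebra.trdeg k (Algebra.adjoin k (Set.range F)) = jacRank F := by
  set B := Algebra.adjoin k (Set.range F)
  let D : Derivation k B (σ → K) := grad.compAlgebraMap B
  have : Algebra.IsAlgebraic (Algebra.adjoin k (Subtype.val ⁻¹' Set.range F : Set B)) B := by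
    rw [Algebra.adjoin_adjoin_coe_preimage]
    exact ⟨fun b => isAlgebraic_algebraMap (⟨b, trivial⟩ : (⊤ : Subalgebra k B))⟩
  obtain ⟨u, huF, hu⟩ :=
    exists_isTranscendenceBasis_subset (R := k) (Subtype.val ⁻¹' Set.range F : Set B)
  have hind : LinearIndependent K fun x : u => D x :=
    linearIndependent_grad (hu.1.map' (f := B.val) Subtype.val_injective)
  have : Algebra.IsAlgebraic (Algebra.adjoin k u) B := by
    have := hu.isAlgebraic
    rwa [Subtype.range_coe] at this
  have : FaithfulSMul B K := inferInstance
  have hspan : Submodule.span K (Set.range fun j => grad (F j)) =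
      Submodule.span K (Set.range fun x : u => D x) := by
    refine le_antisymm (Submodule.span_le.mpr ?_) (Submodule.span_mono ?_)
    · rintro _ ⟨j, rfl⟩
      rw [← Set.image_eq_range]
      exact derivation_mem_span_image D u ⟨F j, Algebra.subset_adjoin ⟨j, rfl⟩⟩
    · rintro _ ⟨x, rfl⟩
      obtain ⟨j, hj⟩ := huF x.2
      exact ⟨j, congrArg grad hj⟩
  have : Finite u := Cardinal.lt_aleph0_iff_finite.mp hind.lt_aleph0_of_finiteDimensional
  have := Fintype.ofFinite u
  rw [jacRank, hspan, finrank_span_eq_card hind, ← hu.cardinalMk_eq_trdeg, ← Cardinal.mk_fintype]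

end Gradient

section Cone

variable {ι : Type*}

/-- The restriction of a polynomial to the line through the origin spanned by `v`, as a polynomial
in one variable. -/
def restrictLine (v : ι → ℂ) : MvPolynomial ι ℂ →ₐ[ℂ] Polynomial ℂ :=
  aeval fun i => Polynomial.C (v i) * Polynomial.X

theorem eval_restrictLine (v : ι → ℂ) (G : MvPolynomial ι ℂ) (c : ℂ) :
    (restrictLine v G).eval c = eval (c • v) G := by
  unfold restrictLine
  induction G using MvPolynomial.induction_on with
  | C a => simp
  | add G H hG hH => simp only [map_add, Polynomial.eval_add, hG, hH]
  | mul_X G i hG => simp [hG, mul_comm c]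

theorem restrictLine_eq_zero_iff {v : ι → ℂ} {G : MvPolynomial ι ℂ} :
    restrictLine v G = 0 ↔ ∀ c : ℂ, eval (c • v) G = 0 := by
  simp only [← eval_restrictLine]
  exact ⟨fun h c => by rw [h, Polynomial.eval_zero],
    fun h => Polynomial.funext fun c => by rw [h, Polynomial.eval_zero]⟩

theorem restrictLine_of_isHomogeneous {m : ℕ} {G : MvPolynomial ι ℂ} (hG : G.IsHomogeneous m)
    (v : ι → ℂ) : restrictLine v G = Polynomial.monomial m (eval v G) :=
  Polynomial.funext fun c => by
    rw [eval_restrictLine, eval_smul hG, Polynomial.eval_monomial, mul_comm]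

theorem coeff_restrictLine (v : ι → ℂ) (G : MvPolynomial ι ℂ) (m : ℕ) :
    (restrictLine v G).coeff m = eval v (homogeneousComponent m G) := by
  have h : restrictLine v G = ∑ i ∈ Finset.range (G.totalDegree + 1),
      Polynomial.monomial i (eval v (homogeneousComponent i G)) := by
    conv_lhs => rw [← sum_homogeneousComponent G, map_sum]
    exact Finset.sum_congr rfl fun i _ =>
      restrictLine_of_isHomogeneous (homogeneousComponent_isHomogeneous i G) v
  rw [h, Polynomial.finsetSum_coeff]
  simp only [Polynomial.coeff_monomial, Finset.sum_ite_eq', Finset.mem_range]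
  split_ifs with hm
  · rfl
  · rw [homogeneousComponent_eq_zero m G (by omega), map_zero]

/-- The points of projective space over which `G` vanishes on the whole line; `G` need not be
homogeneous. -/
def coneZeros (G : MvPolynomial ι ℂ) : Set (Proj ι) := {p | restrictLine p.rep G = 0}

theorem isClosed_coneZeros (G : MvPolynomial ι ℂ) : IsClosed (coneZeros G) := by
  refine (isClosed_iff _).mpr ⟨Set.range fun m => homogeneousComponent m G, ?_, ?_⟩
  · rintro _ ⟨m, rfl⟩
    exact ⟨m, homogeneousComponent_isHomogeneous m G⟩
  · ext p
    simp only [coneZeros, zeroLocus, Set.mem_ofPred_eq, Polynomial.ext_iff, coeff_restrictLine,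
      Polynomial.coeff_zero, Set.forall_mem_range]

theorem mk_mem_coneZeros {G : MvPolynomial ι ℂ} {v : ι → ℂ} (hv : v ≠ 0) :
    Projectivization.mk ℂ v hv ∈ coneZeros G ↔ restrictLine v G = 0 := by
  obtain ⟨a, ha⟩ := Projectivization.exists_smul_eq_mk_rep ℂ v hv
  rw [coneZeros, Set.mem_ofPred_eq, restrictLine_eq_zero_iff, restrictLine_eq_zero_iff, ← ha]
  simp only [Units.smul_def, smul_smul]
  exact ⟨fun h c => by simpa using h (c * (a : ℂ)⁻¹), fun h c => h _⟩

/-- The ideal of the affine cone over a subset of projective space. -/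
def coneIdeal (S : Set (Proj ι)) : Ideal (MvPolynomial ι ℂ) :=
  ⨅ p ∈ S, RingHom.ker (restrictLine p.rep)

theorem mem_coneIdeal {S : Set (Proj ι)} {G : MvPolynomial ι ℂ} :
    G ∈ coneIdeal S ↔ S ⊆ coneZeros G := by
  simp only [coneIdeal, Submodule.mem_iInf, RingHom.mem_ker]
  rfl

theorem coneIdeal_closure (S : Set (Proj ι)) : coneIdeal (closure S) = coneIdeal S := by
  ext G
  rw [mem_coneIdeal, mem_coneIdeal, (isClosed_coneZeros G).closure_subset_iff]

theorem subset_iff_coneIdeal_le {S Z : Set (Proj ι)} (hZ : IsClosed Z) :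
    S ⊆ Z ↔ coneIdeal Z ≤ coneIdeal S := by
  refine ⟨fun h => biInf_mono h, fun h => ?_⟩
  obtain ⟨E, hE, rfl⟩ := (isClosed_iff Z).mp hZ
  intro p hp G hG
  obtain ⟨m, hm⟩ := hE G hG
  have hGZ : G ∈ coneIdeal (zeroLocus E) := mem_coneIdeal.mpr fun q hq => by
    rw [coneZeros, Set.mem_ofPred_eq, restrictLine_of_isHomogeneous hm, hq G hG, map_zero]
  simpa using restrictLine_eq_zero_iff.mp (mem_coneIdeal.mp (h hGZ) hp) 1

theorem isIrreducible_iff_isPrime_coneIdeal {S : Set (Proj ι)} :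
    IsIrreducible S ↔ (coneIdeal S).IsPrime := by
  constructor
  · intro hS
    refine ⟨?_, fun {G H} hGH => ?_⟩
    · obtain ⟨p, hp⟩ := hS.nonempty
      intro h
      have := mem_coneIdeal.mp ((Ideal.eq_top_iff_one _).mp h) hp
      simp [coneZeros] at this
    · simp only [mem_coneIdeal] at hGH ⊢
      refine isPreirreducible_iff_isClosed_union_isClosed.mp hS.isPreirreducible _ _
        (isClosed_coneZeros G) (isClosed_coneZeros H) (hGH.trans fun p hp => ?_)
      rw [coneZeros, Set.mem_ofPred_eq, map_mul, mul_eq_zero] at hp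
      exact hp
  · intro hS
    refine ⟨Set.nonempty_iff_ne_empty.mpr ?_,
      isPreirreducible_iff_isClosed_union_isClosed.mpr fun Z₁ Z₂ hZ₁ hZ₂ h => ?_⟩
    · rintro rfl
      exact hS.ne_top (by simp [coneIdeal])
    · rw [subset_iff_coneIdeal_le hZ₁, subset_iff_coneIdeal_le hZ₂, ← hS.inf_le]
      rw [subset_iff_coneIdeal_le (hZ₁.union hZ₂)] at h
      exact (le_of_eq iInf_union.symm).trans h

/-- The dimension of the affine cone over a subset of projective space: the transcendence degree of
its homogeneous coordinate ring. It exceeds the projective dimension by one. -/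
def coneDim (S : Set (Proj ι)) : ℕ := (Algebra.trdeg ℂ (MvPolynomial ι ℂ ⧸ coneIdeal S)).toNat

variable [Finite ι]

theorem coneDim_lt_coneDim {S T : Set (Proj ι)} (hS : IsIrreducible S) (hT : IsIrreducible T)
    (hSc : IsClosed S) (hST : S ⊂ T) : coneDim S < coneDim T := by
  have := isIrreducible_iff_isPrime_coneIdeal.mp hS
  have := isIrreducible_iff_isPrime_coneIdeal.mp hT
  have hle : coneIdeal T ≤ coneIdeal S := biInf_mono hST.1
  by_contra! h
  refine hST.2 ((subset_iff_coneIdeal_le hSc).mpr fun G hG => ?_)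
  have hinj := injective_of_surjective_of_lift_trdeg_le (Ideal.Quotient.factorₐ ℂ hle)
    (Ideal.Quotient.factor_surjective hle) trdeg_lt_aleph0_of_finiteType
    (Cardinal.lift_le.mpr ((Cardinal.toNat_le_iff_le_of_lt_aleph0 trdeg_lt_aleph0_of_finiteType
      trdeg_lt_aleph0_of_finiteType).mp h))
  rw [← Ideal.Quotient.eq_zero_iff_mem] at hG ⊢
  refine hinj ?_
  rw [map_zero]
  exact hG

theorem coneDim_pos {S : Set (Proj ι)} (hS : S.Nonempty) : 0 < coneDim S := by
  obtain ⟨p, hp⟩ := hS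
  obtain ⟨j, hj⟩ := Function.ne_iff.mp p.rep_nonzero
  let φ : MvPolynomial ι ℂ ⧸ coneIdeal S →ₐ[ℂ] Polynomial ℂ :=
    Ideal.Quotient.liftₐ _ (restrictLine p.rep) fun G hG => mem_coneIdeal.mp hG hp
  have hφ : Function.Surjective φ := by
    rw [← AlgHom.range_eq_top, eq_top_iff, ← Polynomial.adjoin_X, Algebra.adjoin_le_iff,
      Set.singleton_subset_iff]
    refine ⟨Ideal.Quotient.mk _ (C (p.rep j)⁻¹ * X j), ?_⟩
    change restrictLine p.rep (C (p.rep j)⁻¹ * X j) = Polynomial.X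
    have hj' : (p.rep j)⁻¹ * p.rep j = 1 := inv_mul_cancel₀ hj
    rw [restrictLine, map_mul, aeval_X, algHom_C, Polynomial.algebraMap_eq, ← mul_assoc,
      ← Polynomial.C_mul, hj', Polynomial.C_1, one_mul]
  have htrdeg := lift_trdeg_le_of_surjective φ hφ
  rw [Polynomial.trdeg_of_isDomain, Cardinal.lift_one, Cardinal.one_le_lift_iff,
    Cardinal.one_le_iff_ne_zero] at htrdeg
  exact Cardinal.toNat_pos.mpr ⟨htrdeg, trdeg_lt_aleph0_of_finiteType⟩

end Cone

section Image

variable {σ ι : Type*} {F : ι → MvPolynomial σ ℂ} {m : ℕ}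

theorem eval_aeval_family {R : Type*} [CommSemiring R] (v : σ → R) (F : ι → MvPolynomial σ R)
    (G : MvPolynomial ι R) :
    eval v (aeval F G) = eval (fun j => eval v (F j)) G := by
  rw [← coe_aeval_eq_eval, ← coe_aeval_eq_eval]
  exact comp_aeval_apply F (aeval v) G

theorem mem_ran_ratMap (hF : ∀ j, (F j).IsHomogeneous m) (hm : m ≠ 0) {q : Proj ι} :
    q ∈ (ratMap F).ran ↔
      ∃ v, ∃ h : (fun j => eval v (F j)) ≠ 0, q = Projectivization.mk ℂ _ h := by
  constructor
  · rintro ⟨p, hq⟩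
    induction p using Projectivization.ind with | _ v hv =>
    exact ⟨v, (mem_ratMap_mk hF v hv q).mp hq⟩
  · rintro ⟨v, h, rfl⟩
    have hv : v ≠ 0 := by
      rintro rfl
      refine h (funext fun j => ?_)
      simpa [hm] using eval_smul (hF j) 0 0
    exact ⟨Projectivization.mk ℂ v hv, (mem_ratMap_mk hF v hv _).mpr ⟨h, rfl⟩⟩

theorem coneIdeal_closure_ran (hF : ∀ j, (F j).IsHomogeneous m) (hm : m ≠ 0) (hF0 : F ≠ 0) :
    coneIdeal (closure (ratMap F).ran) =
      RingHom.ker (aeval F : MvPolynomial ι ℂ →ₐ[ℂ] MvPolynomial σ ℂ) := by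
  rw [coneIdeal_closure]
  ext G
  rw [mem_coneIdeal, RingHom.mem_ker]
  constructor
  · intro h
    obtain ⟨j, hj⟩ := Function.ne_iff.mp hF0
    suffices F j * aeval F G = 0 from (mul_eq_zero.mp this).resolve_left hj
    refine MvPolynomial.funext fun v => ?_
    rw [map_mul, map_zero, mul_eq_zero, or_iff_not_imp_left]
    intro hvj
    have hFv : (fun j => eval v (F j)) ≠ 0 := fun h => hvj (congrFun h j)
    have := (mk_mem_coneZeros hFv).mp (h ((mem_ran_ratMap hF hm).mpr ⟨v, hFv, rfl⟩))
    rw [eval_aeval_family, ← restrictLine_eq_zero_iff.mp this 1, one_smul]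
  · rintro h q hq
    obtain ⟨v, hFv, rfl⟩ := (mem_ran_ratMap hF hm).mp hq
    rw [mk_mem_coneZeros, restrictLine_eq_zero_iff]
    intro c
    obtain ⟨t, rfl⟩ := IsAlgClosed.exists_pow_nat_eq c (Nat.pos_of_ne_zero hm)
    have hFtv : (t ^ m • fun j => eval v (F j)) = fun j => eval (t • v) (F j) :=
      funext fun j => (eval_smul (hF j) t v).symm
    rw [hFtv, ← eval_aeval_family, h, map_zero]

theorem isIrreducible_closure_ran (hF : ∀ j, (F j).IsHomogeneous m) (hm : m ≠ 0) (hF0 : F ≠ 0) :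
    IsIrreducible (closure (ratMap F).ran) := by
  rw [isIrreducible_iff_isPrime_coneIdeal, coneIdeal_closure_ran hF hm hF0]
  exact RingHom.ker_isPrime _

theorem coneDim_closure_ran [Finite σ] (hF : ∀ j, (F j).IsHomogeneous m) (hm : m ≠ 0)
    (hF0 : F ≠ 0) : coneDim (closure (ratMap F).ran) = jacRank F := by
  have e := Ideal.quotientKerEquivRange (R := ℂ)
    (aeval F : MvPolynomial ι ℂ →ₐ[ℂ] MvPolynomial σ ℂ)
  rw [← Algebra.adjoin_range_eq_range_aeval] at e
  rw [coneDim, coneIdeal_closure_ran hF hm hF0, ← Cardinal.toNat_lift, e.lift_trdeg_eq,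
    trdeg_adjoin_eq_jacRank, Cardinal.toNat_lift, Cardinal.toNat_natCast]

end Image

section KrullDim

theorem isIrreducible_of_image {X Y : Type*} [TopologicalSpace X] [TopologicalSpace Y]
    {f : X → Y} (hf : Topology.IsInducing f) {s : Set X} (hs : IsIrreducible (f '' s)) :
    IsIrreducible s := by
  refine ⟨hs.nonempty.of_image, fun u v hu hv hsu hsv => ?_⟩
  obtain ⟨u', hu', rfl⟩ := hf.isOpen_iff.mp hu
  obtain ⟨v', hv', rfl⟩ := hf.isOpen_iff.mp hv
  obtain ⟨_, ⟨x, hx, rfl⟩, hxu, hxv⟩ := hs.isPreirreducible u' v' hu' hv'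
    (hsu.elim fun x hx => ⟨f x, ⟨x, hx.1, rfl⟩, hx.2⟩)
    (hsv.elim fun x hx => ⟨f x, ⟨x, hx.1, rfl⟩, hx.2⟩)
  exact ⟨x, hx, hxu, hxv⟩

theorem le_topologicalKrullDim_of_strictMono {X : Type*} [TopologicalSpace X] {Z : Set X} {r : ℕ}
    {W : Fin (r + 1) → Set X} (hW : StrictMono W) (hirr : ∀ i, IsIrreducible (W i))
    (hclosed : ∀ i, IsClosed (W i)) (hWZ : ∀ i, W i ⊆ Z) : r ≤ topologicalKrullDim Z := by
  have himage (i) : (↑) '' ((↑) ⁻¹' W i : Set Z) = W i := by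
    rw [Subtype.image_preimage_coe, Set.inter_eq_right.mpr (hWZ i)]
  let V (i : Fin (r + 1)) : TopologicalSpace.IrreducibleCloseds Z :=
    { carrier := (↑) ⁻¹' W i
      isIrreducible' :=
        isIrreducible_of_image Topology.IsInducing.subtypeVal ((himage i).symm ▸ hirr i)
      isClosed' := (hclosed i).preimage continuous_subtype_val }
  have hV : StrictMono V := fun i j hij => by
    refine lt_of_le_of_ne (fun z hz => (hW hij).1 hz) fun h => (hW hij).ne ?_
    have hVij : ((↑) ⁻¹' W i : Set Z) = (↑) ⁻¹' W j := congrArg (fun V => V.carrier) h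
    rw [← himage i, hVij, himage j]
  exact Order.le_krullDim_iff.mpr ⟨LTSeries.mk r V hV, rfl⟩

theorem topologicalKrullDim_add_one_le_coneDim {ι : Type*} [Finite ι] {Z : Set (Proj ι)}
    (hZ : IsIrreducible Z) (hZc : IsClosed Z) : topologicalKrullDim Z + 1 ≤ coneDim Z := by
  let V := TopologicalSpace.IrreducibleCloseds.map ((↑) : Z → Proj ι) continuous_subtype_val
  have hVZ (W) : (V W : Set (Proj ι)) ⊆ Z := by
    rw [TopologicalSpace.IrreducibleCloseds.coe_map]
    exact closure_minimal (Subtype.coe_image_subset _ _) hZc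
  have hV : StrictMono fun W => coneDim (V W : Set (Proj ι)) := fun W W' h =>
    coneDim_lt_coneDim (V W).isIrreducible (V W').isIrreducible (V W).isClosed
      (TopologicalSpace.IrreducibleCloseds.map_strictMono_of_isInducing
        Topology.IsInducing.subtypeVal h)
  have hle (W) : coneDim (V W : Set (Proj ι)) ≤ coneDim Z := by
    rcases (hVZ W).eq_or_ssubset with h | h
    · rw [h]
    · exact (coneDim_lt_coneDim (V W).isIrreducible hZ (V W).isClosed h).le
  obtain ⟨r, hr⟩ := Nat.exists_eq_add_one_of_ne_zero (coneDim_pos hZ.nonempty).ne'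
  have hdim : topologicalKrullDim Z ≤ r := iSup_le fun p => by
    have hhead := LTSeries.head_add_length_le_nat (p.map _ hV)
    have hpos : 0 < (p.map _ hV).head := coneDim_pos (V _).isIrreducible.nonempty
    have hlast : (p.map _ hV).last ≤ coneDim Z := hle _
    have : p.length = (p.map _ hV).length := rfl
    exact_mod_cast (show p.length ≤ r by omega)
  rw [hr]
  exact_mod_cast add_le_add_left hdim 1

end KrullDim

section Rank

theorem exists_linearIndependent_row_comp {K m n : Type*} [Field K] [Finite m] [Fintype n]
    (M : Matrix m n K) : ∃ e : Fin M.rank → m, LinearIndependent K (M.row ∘ e) := by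
  rw [M.rank_eq_finrank_span_row]
  obtain ⟨v, hv, -, hind⟩ := Submodule.exists_fun_fin_finrank_span_eq K (Set.range M.row)
  choose e he using hv
  have hMe : M.row ∘ e = v := funext he
  exact ⟨e, hMe ▸ hind⟩

theorem exists_det_submatrix_ne_zero {K m n : Type*} [Field K] [Finite m] [Fintype n]
    (M : Matrix m n K) :
    ∃ (e : Fin M.rank → m) (f : Fin M.rank → n), (M.submatrix e f).det ≠ 0 := by
  obtain ⟨e, he⟩ := exists_linearIndependent_row_comp M
  have hrank : (M.submatrix e id).transpose.rank = M.rank := by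
    have := LinearIndependent.rank_matrix (M := M.submatrix e id) he
    rw [Matrix.rank_transpose, this, Fintype.card_fin]
  have hrow := exists_linearIndependent_row_comp (M.submatrix e id).transpose
  rw [hrank] at hrow
  obtain ⟨f, hf⟩ := hrow
  refine ⟨e, f, ?_⟩
  rw [← Matrix.det_transpose, ← isUnit_iff_ne_zero, ← Matrix.isUnit_iff_isUnit_det,
    ← Matrix.linearIndependent_rows_iff_isUnit]
  exact hf

theorem le_rank_of_det_submatrix_ne_zero {R m n : Type*} [CommRing R] [IsDomain R] [Fintype n]
    {M : Matrix m n R} {r : ℕ} {e : Fin r → m} {f : Fin r → n}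
    (h : (M.submatrix e f).det ≠ 0) : r ≤ M.rank := by
  simpa [Matrix.rank_of_det_ne_zero h] using M.rank_submatrix_le e f

variable {σ ι κ : Type*} [Finite ι] [Fintype κ]

theorem rank_map_eval_le_genericRank (M : Matrix ι κ (MvPolynomial σ ℂ)) (v : σ → ℂ) :
    (M.map (eval v)).rank ≤ genericRank M := by
  obtain ⟨e, f, h⟩ := exists_det_submatrix_ne_zero (M.map (eval v))
  refine le_rank_of_det_submatrix_ne_zero (e := e) (f := f) fun h0 => h ?_
  rw [Matrix.submatrix_map, ← RingHom.mapMatrix_apply, ← RingHom.map_det] at h0 ⊢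
  rw [(map_eq_zero_iff _ (IsFractionRing.injective _ _)).mp h0, map_zero]

theorem exists_genericRank_le_rank_map_eval (M : Matrix ι κ (MvPolynomial σ ℂ))
    {g : MvPolynomial σ ℂ} (hg : g ≠ 0) :
    ∃ v, eval v g ≠ 0 ∧ genericRank M ≤ (M.map (eval v)).rank := by
  unfold genericRank
  obtain ⟨e, f, h⟩ := exists_det_submatrix_ne_zero
    (M.map (algebraMap (MvPolynomial σ ℂ) (FractionRing (MvPolynomial σ ℂ))))
  rw [Matrix.submatrix_map, ← RingHom.mapMatrix_apply, ← RingHom.map_det] at h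
  obtain ⟨v, hv⟩ : ∃ v, eval v (g * (M.submatrix e f).det) ≠ 0 := by
    by_contra! hv
    refine mul_ne_zero hg (fun h0 => h ?_) (MvPolynomial.funext hv)
    rw [h0, map_zero]
  rw [map_mul] at hv
  refine ⟨v, left_ne_zero_of_mul hv, le_rank_of_det_submatrix_ne_zero (e := e) (f := f) ?_⟩
  rw [Matrix.submatrix_map, ← RingHom.mapMatrix_apply, ← RingHom.map_det]
  exact right_ne_zero_of_mul hv

end Rank

section Jacobian

variable {σ ι R : Type*} [CommSemiring R]

/-- The Jacobian matrix of a family of polynomials, with one row for each variable. -/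
def jacobian (F : ι → MvPolynomial σ R) : Matrix σ ι (MvPolynomial σ R) :=
  Matrix.of fun l j => pderiv l (F j)

theorem genericRank_jacobian [Fintype ι] (F : ι → MvPolynomial σ ℂ) :
    genericRank (jacobian F) = jacRank F := by
  have hcol : ((jacobian F).map (algebraMap _ (FractionRing (MvPolynomial σ ℂ)))).col =
      fun j => grad (F j) := funext₂ fun j l => (grad_apply (F j) l).symm
  rw [genericRank, Matrix.rank_eq_finrank_span_cols, hcol, jacRank]

theorem jacRank_le_card {k : Type*} [Field k] [Fintype σ] (F : ι → MvPolynomial σ k) :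
    jacRank F ≤ Fintype.card σ :=
  (Submodule.finrank_le _).trans_eq (Module.finrank_pi _)

/-- The derivative of polynomials in the direction of the vector `v`. -/
def dirDeriv (v : σ → R) : Derivation R (MvPolynomial σ R) (MvPolynomial σ R) :=
  mkDerivation R fun l => C (v l)

theorem dirDeriv_eq_sum [Fintype σ] (v : σ → R) (g : MvPolynomial σ R) :
    dirDeriv v g = ∑ l, C (v l) * pderiv l g := by
  classical
  induction g using MvPolynomial.induction_on with
  | C a => rw [← algebraMap_eq]; simp
  | add p q hp hq => simp only [map_add, hp, hq, mul_add, Finset.sum_add_distrib]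
  | mul_X p i hp =>
    have hX : dirDeriv v (X i) = ∑ l, C (v l) * pderiv l (X i : MvPolynomial σ R) := by
      simp [dirDeriv, mkDerivation_X, pderiv_X, Pi.single_apply]
    simp only [Derivation.leibniz, hp, hX, smul_eq_mul, mul_add, Finset.sum_add_distrib,
      Finset.mul_sum, mul_left_comm]

theorem eval_self_dirDeriv [Finite σ] {m : ℕ} {g : MvPolynomial σ R} (hg : g.IsHomogeneous m)
    (v : σ → R) : eval v (dirDeriv v g) = m * eval v g := by
  have := Fintype.ofFinite σ
  simpa [dirDeriv_eq_sum] using congrArg (eval v) hg.sum_X_mul_pderiv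

theorem vecMul_map_eval_jacobian [Fintype σ] (F : ι → MvPolynomial σ R) (v w : σ → R) :
    Matrix.vecMul w ((jacobian F).map (eval v)) = fun j => eval v (dirDeriv w (F j)) := by
  ext j
  simp [dirDeriv_eq_sum, Matrix.vecMul, dotProduct, jacobian]

end Jacobian

section Restriction

variable {σ τ ι R : Type*} [CommSemiring R] [Fintype τ]

/-- The restriction of polynomials to the span of the vectors `w i`, in the coordinates given
by the `w i`. -/
def restrictSpan (w : τ → σ → R) : MvPolynomial σ R →ₐ[R] MvPolynomial τ R :=
  aeval fun l => ∑ i, C (w i l) * X i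

theorem eval_restrictSpan (w : τ → σ → R) (t : τ → R) (g : MvPolynomial σ R) :
    eval t (restrictSpan w g) = eval (Fintype.linearCombination R w t) g := by
  rw [restrictSpan, eval_aeval_family]
  congr 2
  ext l
  simp [Fintype.linearCombination_apply, mul_comm]

theorem isHomogeneous_restrictSpan (w : τ → σ → R) {m : ℕ} {g : MvPolynomial σ R}
    (hg : g.IsHomogeneous m) : (restrictSpan w g).IsHomogeneous m := by
  have := hg.aeval (fun l => ∑ i, C (w i l) * X i : σ → MvPolynomial τ R) (n := 1)
    fun l => IsHomogeneous.sum _ _ _ fun i _ => isHomogeneous_C_mul_X _ _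
  rwa [one_mul] at this

theorem pderiv_restrictSpan (w : τ → σ → R) (i : τ) (g : MvPolynomial σ R) :
    pderiv i (restrictSpan w g) = restrictSpan w (dirDeriv (w i) g) := by
  classical
  induction g using MvPolynomial.induction_on with
  | C a => rw [← algebraMap_eq]; simp
  | add p q hp hq => simp only [map_add, hp, hq]
  | mul_X p l hp =>
    have hX : pderiv i (restrictSpan w (X l)) = restrictSpan w (dirDeriv (w i) (X l)) := by
      simp [restrictSpan, dirDeriv, mkDerivation_X, pderiv_X, Pi.single_apply, Derivation.leibniz]
    simp only [map_mul, Derivation.leibniz, hp, hX, smul_eq_mul, map_add]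

theorem jacRank_restrictSpan [Fintype σ] [Finite ι] {F : ι → MvPolynomial σ ℂ} {w : τ → σ → ℂ}
    (t : τ → ℂ) (hw : LinearIndependent ℂ fun i =>
      Matrix.vecMul (w i) ((jacobian F).map (eval (Fintype.linearCombination ℂ w t)))) :
    jacRank (fun j => restrictSpan w (F j)) = Fintype.card τ := by
  have := Fintype.ofFinite ι
  refine le_antisymm (jacRank_le_card _) ?_
  have hrow : LinearIndependent ℂ
      ((jacobian fun j => restrictSpan w (F j)).map (eval t)).row := by
    convert hw using 2 with i
    rw [vecMul_map_eval_jacobian]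
    ext j
    rw [← eval_restrictSpan, ← pderiv_restrictSpan]
    rfl
  rw [← genericRank_jacobian, ← hrow.rank_matrix]
  exact rank_map_eval_le_genericRank _ t

theorem mem_ran_ratMap_restrictSpan {F : ι → MvPolynomial σ ℂ} {m : ℕ}
    (hF : ∀ j, (F j).IsHomogeneous m) (hm : m ≠ 0) (w : τ → σ → ℂ) {q : Proj ι} :
    q ∈ (ratMap fun j => restrictSpan w (F j)).ran ↔
      ∃ v ∈ Submodule.span ℂ (Set.range w), ∃ h : (fun j => eval v (F j)) ≠ 0,
        q = Projectivization.mk ℂ _ h := by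
  rw [mem_ran_ratMap (fun j => isHomogeneous_restrictSpan w (hF j)) hm,
    ← Fintype.range_linearCombination]
  simp only [eval_restrictSpan, LinearMap.mem_range, exists_exists_eq_and]

end Restriction

section Dimension

theorem exists_linearIndependent_zero_eq {K V : Type*} [Field K] [AddCommGroup V] [Module K V]
    {x : V} (hx : x ≠ 0) {r : ℕ} (hr : r + 1 ≤ Module.finrank K V) :
    ∃ y : Fin (r + 1) → V, LinearIndependent K y ∧ y 0 = x := by
  induction r with
  | zero => exact ⟨![x], by simpa [linearIndependent_unique_iff] using hx, rfl⟩
  | succ r ih =>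
    obtain ⟨y, hy, hy0⟩ := ih (by omega)
    obtain ⟨z, hz⟩ := exists_linearIndependent_snoc_of_lt_finrank hy hr
    refine ⟨Fin.snoc y z, hz, ?_⟩
    rw [← Fin.castSucc_zero, Fin.snoc_castSucc, hy0]

theorem exists_linearIndependent_map_zero_eq {K V W : Type*} [Field K] [AddCommGroup V] [Module K V]
    [AddCommGroup W] [Module K W] (T : V →ₗ[K] W) {v : V} (hv : T v ≠ 0) {r : ℕ}
    (hr : r + 1 ≤ Module.finrank K (LinearMap.range T)) :
    ∃ w : Fin (r + 1) → V, LinearIndependent K (T ∘ w) ∧ w 0 = v := by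
  obtain ⟨y, hy, hy0⟩ := exists_linearIndependent_zero_eq
    (x := (⟨T v, v, rfl⟩ : LinearMap.range T)) (fun h => hv (congrArg Subtype.val h)) hr
  choose u hu using fun i => (y i).2
  refine ⟨Function.update u 0 v, ?_, Function.update_self ..⟩
  have hTw : T ∘ Function.update u 0 v = (↑) ∘ y := by
    funext i
    by_cases hi : i = 0
    · subst hi
      simp [hy0]
    · simp [hi, hu]
  rw [hTw]
  exact hy.map' (Submodule.subtype _) (Submodule.ker_subtype _)

variable {σ ι : Type*} [Finite σ] [Finite ι] {F : ι → MvPolynomial σ ℂ} {m : ℕ}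

theorem exists_frame [Fintype σ] (hF : ∀ j, (F j).IsHomogeneous m) (hm : m ≠ 0) (hF0 : F ≠ 0)
    {r : ℕ} (hr : jacRank F = r + 1) :
    ∃ w : Fin (r + 1) → σ → ℂ, (∃ j, eval (w 0) (F j) ≠ 0) ∧
      LinearIndependent ℂ fun i => Matrix.vecMul (w i) ((jacobian F).map (eval (w 0))) := by
  have := Fintype.ofFinite ι
  obtain ⟨j, hj⟩ := Function.ne_iff.mp hF0
  obtain ⟨v, hv, hrank⟩ := exists_genericRank_le_rank_map_eval (jacobian F) hj
  set T := ((jacobian F).map (eval v)).vecMulLinear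
  rw [genericRank_jacobian, hr, Matrix.rank_eq_finrank_span_row, ← range_vecMulLinear]
    at hrank
  -- By Euler's identity `T v = m • F(v)`.
  have hTv : T v ≠ 0 := fun h => by
    have hTvj := congrFun h j
    simp only [T, Matrix.vecMulLinear_apply, vecMul_map_eval_jacobian, eval_self_dirDeriv (hF j)]
      at hTvj
    exact mul_ne_zero (Nat.cast_ne_zero.mpr hm) hv hTvj
  obtain ⟨w, hw, rfl⟩ := exists_linearIndependent_map_zero_eq T hTv hrank
  exact ⟨w, ⟨j, hv⟩, hw⟩

-- The chain of subvarieties consists of the images of the linear spaces spanned by `w 0, …, w i`.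
theorem le_topologicalKrullDim_closure_ran (hF : ∀ j, (F j).IsHomogeneous m) (hm : m ≠ 0)
    (hF0 : F ≠ 0) {r : ℕ} (hr : jacRank F = r + 1) :
    r ≤ topologicalKrullDim (closure (ratMap F).ran) := by
  have := Fintype.ofFinite σ
  obtain ⟨w, ⟨j, hj⟩, hw⟩ := exists_frame hF hm hF0 hr
  let w' (i : Fin (r + 1)) (a : Set.Iic i) : σ → ℂ := w a
  let G (i : Fin (r + 1)) (j : ι) := restrictSpan (w' i) (F j)
  have hpoint (i) :
      Fintype.linearCombination ℂ (w' i) (Pi.single ⟨0, Fin.zero_le i⟩ 1) = w 0 := by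
    rw [Fintype.linearCombination_apply_single, one_smul]
  have hG (i j) : (G i j).IsHomogeneous m := isHomogeneous_restrictSpan _ (hF j)
  have hG0 (i) : G i ≠ 0 := fun h => hj <| by
    rw [← hpoint i, ← eval_restrictSpan, show restrictSpan (w' i) (F j) = 0 from congrFun h j,
      map_zero]
  have hGdim (i) : coneDim (closure (ratMap (G i)).ran) = i + 1 := by
    rw [coneDim_closure_ran (hG i) hm (hG0 i),
      jacRank_restrictSpan (Pi.single ⟨0, Fin.zero_le i⟩ 1)]
    · rw [← Set.toFinset_card, Set.toFinset_Iic, Fin.card_Iic]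
    · rw [hpoint]
      exact hw.comp _ Subtype.val_injective
  refine le_topologicalKrullDim_of_strictMono (W := fun i => closure (ratMap (G i)).ran)
    (fun i i' hi => ssubset_of_subset_of_ne (closure_mono fun q => ?_) fun h => ?_)
    (fun i => isIrreducible_closure_ran (hG i) hm (hG0 i)) (fun i => isClosed_closure)
    (fun i => closure_mono fun q => ?_)
  · rw [mem_ran_ratMap_restrictSpan hF hm, mem_ran_ratMap_restrictSpan hF hm]
    rintro ⟨v, hv, hq⟩
    refine ⟨v, Submodule.span_mono ?_ hv, hq⟩
    rintro _ ⟨a, rfl⟩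
    exact ⟨⟨a, a.2.trans hi.le⟩, rfl⟩
  · have := congrArg coneDim h
    rw [hGdim, hGdim, Nat.add_right_cancel_iff] at this
    exact hi.ne (Fin.ext this)
  · rw [mem_ran_ratMap_restrictSpan hF hm, mem_ran_ratMap hF hm]
    exact fun ⟨v, _, hq⟩ => ⟨v, hq⟩

theorem topologicalKrullDim_closure_ran (hF : ∀ j, (F j).IsHomogeneous m) (hm : m ≠ 0)
    (hF0 : F ≠ 0) : topologicalKrullDim (closure (ratMap F).ran) + 1 = jacRank F := by
  have hirr := isIrreducible_closure_ran hF hm hF0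
  have hpos := coneDim_pos hirr.nonempty
  rw [coneDim_closure_ran hF hm hF0] at hpos
  obtain ⟨r, hr⟩ := Nat.exists_eq_add_one_of_ne_zero hpos.ne'
  refine le_antisymm ?_ ?_
  · rw [← coneDim_closure_ran hF hm hF0]
    exact topologicalKrullDim_add_one_le_coneDim hirr isClosed_closure
  · rw [hr]
    exact_mod_cast add_le_add_left (le_topologicalKrullDim_closure_ran hF hm hF0 hr) 1

end Dimension

section Apolarity

variable {σ : Type*}

theorem notMem_vars_of_pderiv_eq_zero {R : Type*} [CommSemiring R] [NoZeroDivisors R] [CharZero R]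
    {i : σ} {g : MvPolynomial σ R} (h : pderiv i g = 0) : i ∉ g.vars := by
  classical
  rw [mem_vars_iff_mem_support]
  rintro ⟨s, hs, his⟩
  have hsub : s - Finsupp.single i 1 + Finsupp.single i 1 = s := tsub_add_cancel_of_le <|
    Finsupp.single_le_iff.mpr (Nat.one_le_iff_ne_zero.mpr (Finsupp.mem_support_iff.mp his))
  have hcoeff := congrArg (coeff (s - Finsupp.single i 1)) h
  rw [coeff_pderiv, hsub, coeff_zero] at hcoeff
  exact (mul_eq_zero.mp hcoeff).elim (mem_support_iff.mp hs) (Nat.cast_add_one_ne_zero _)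

theorem exists_pderiv_ne_zero {R : Type*} [CommSemiring R] [NoZeroDivisors R] [CharZero R]
    {e : ℕ} {g : MvPolynomial σ R} (hg : g.IsHomogeneous e) (hg0 : g ≠ 0) (he : e ≠ 0) :
    ∃ i, pderiv i g ≠ 0 := by
  by_contra! h
  have hvars : g.vars = ∅ :=
    Finset.eq_empty_of_forall_notMem fun i => notMem_vars_of_pderiv_eq_zero (h i)
  rw [← hg.totalDegree hg0, vars_eq_empty_iff_eq_C.mp hvars, totalDegree_C] at he
  exact he rfl

theorem homogeneousSubmodule_eq_span_prod_X {R : Type*} [CommSemiring R] (k : ℕ) :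
    homogeneousSubmodule σ R k =
      Submodule.span R (Set.range fun s : Sym σ k => ((s : Multiset σ).map X).prod) := by
  induction k with
  | zero =>
    rw [homogeneousSubmodule_zero, Submodule.one_eq_span, Set.range_unique]
    rfl
  | succ k ih =>
    rw [← homogeneousSubmodule_one_pow, pow_succ', homogeneousSubmodule_one_pow, ih,
      homogeneousSubmodule_one_eq_span_X, Submodule.span_mul_span]
    congr 1
    ext p
    constructor
    · rintro ⟨_, ⟨i, rfl⟩, _, ⟨s, rfl⟩, rfl⟩
      exact ⟨i ::ₛ s, by simp [Sym.coe_cons]⟩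
    · rintro ⟨s, rfl⟩
      obtain ⟨i, t, rfl⟩ := s.exists_eq_cons_of_succ
      exact ⟨X i, ⟨i, rfl⟩, _, ⟨t, rfl⟩, by simp [Sym.coe_cons]⟩

theorem diffOp_mul_apply (α β g : MvPolynomial σ ℂ) :
    diffOp (α * β) g = diffOp α (diffOp β g) := by
  rw [map_mul, Module.End.mul_apply]

theorem isHomogeneous_diffOp_prod_X {e : ℕ} {g : MvPolynomial σ ℂ} (hg : g.IsHomogeneous e)
    (t : Multiset σ) : (diffOp (t.map X).prod g).IsHomogeneous (e - Multiset.card t) := by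
  induction t using Multiset.induction_on with
  | empty => simpa using hg
  | cons i t ih =>
    rw [Multiset.map_cons, Multiset.prod_cons, diffOp_mul_apply, diffOp_X, Multiset.card_cons,
      ← Nat.sub_sub]
    exact ih.pderiv

theorem isHomogeneous_diffOp {k e : ℕ} {α g : MvPolynomial σ ℂ} (hα : α.IsHomogeneous k)
    (hg : g.IsHomogeneous e) : (diffOp α g).IsHomogeneous (e - k) := by
  suffices homogeneousSubmodule σ ℂ k ≤
      (homogeneousSubmodule σ ℂ (e - k)).comap (diffOp.toLinearMap.flip g) from this hα
  rw [homogeneousSubmodule_eq_span_prod_X, Submodule.span_le]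
  rintro _ ⟨s, rfl⟩
  simpa using isHomogeneous_diffOp_prod_X hg s

theorem exists_diffOp_ne_zero {k e : ℕ} {g : MvPolynomial σ ℂ} (hg : g.IsHomogeneous e)
    (hg0 : g ≠ 0) (hke : k ≤ e) : ∃ β : MvPolynomial σ ℂ, β.IsHomogeneous k ∧ diffOp β g ≠ 0 := by
  induction k with
  | zero => exact ⟨1, isHomogeneous_one _ _, by simpa using hg0⟩
  | succ k ih =>
    obtain ⟨β, hβ, hβg⟩ := ih (by omega)
    obtain ⟨i, hi⟩ := exists_pderiv_ne_zero (isHomogeneous_diffOp hβ hg) hβg (by omega)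
    refine ⟨β * X i, hβ.mul (isHomogeneous_X ℂ i), ?_⟩
    rwa [mul_comm, diffOp_mul_apply, diffOp_X]

variable [Fintype σ]

/-- The linear form with coefficient vector `v`, as an element of the ring of differential
operators; it acts as the derivative in the direction `v`. -/
def linForm {R : Type*} [CommSemiring R] (v : σ → R) : MvPolynomial σ R := ∑ i, C (v i) * X i

theorem isHomogeneous_one_iff {R : Type*} [CommSemiring R] {l : MvPolynomial σ R} :
    l.IsHomogeneous 1 ↔ ∃ v, linForm v = l := by
  rw [← mem_homogeneousSubmodule, homogeneousSubmodule_one_eq_span_X,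
    Submodule.mem_span_range_iff_exists_fun]
  simp only [linForm, smul_eq_C_mul]

theorem diffOp_linForm (v : σ → ℂ) (g : MvPolynomial σ ℂ) :
    diffOp (linForm v) g = dirDeriv v g := by
  simp only [linForm, dirDeriv_eq_sum, ← smul_eq_C_mul, map_sum, map_smul, LinearMap.sum_apply,
    LinearMap.smul_apply, diffOp_X]

theorem diffOp_linForm_pow (v : σ → ℂ) {m : ℕ} {g : MvPolynomial σ ℂ} (hg : g.IsHomogeneous m) :
    diffOp (linForm v ^ m) g = C (m.factorial * eval v g) := by
  induction m generalizing g with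
  | zero =>
    rw [← totalDegree_zero_iff_isHomogeneous, totalDegree_eq_zero_iff_eq_C] at hg
    rw [hg]
    simp
  | succ m ih =>
    have hderiv : (diffOp (linForm v) g).IsHomogeneous m :=
      isHomogeneous_diffOp (isHomogeneous_one_iff.mpr ⟨v, rfl⟩) hg
    rw [pow_succ, diffOp_mul_apply, ih hderiv, diffOp_linForm, eval_self_dirDeriv hg,
      Nat.factorial_succ]
    push_cast
    ring_nf

end Apolarity

section ApolarAlgebra

variable {σ : Type*} {f : MvPolynomial σ ℂ}

theorem act_injective : Function.Injective (act f) := by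
  rw [injective_iff_map_eq_zero]
  intro x hx
  obtain ⟨α, rfl⟩ := Ideal.Quotient.mk_surjective x
  exact Ideal.Quotient.eq_zero_iff_mem.mpr hx

theorem act_mk_mul (α : MvPolynomial σ ℂ) (x : A f) :
    act f (Ideal.Quotient.mk (Ann f) α * x) = diffOp α (act f x) := by
  obtain ⟨β, rfl⟩ := Ideal.Quotient.mk_surjective x
  rw [← map_mul, act_mk, act_mk, diffOp_mul_apply]

theorem isHomogeneous_act {d k : ℕ} (hf : f.IsHomogeneous d) {x : A f}
    (hx : x ∈ gradedPiece f k) : (act f x).IsHomogeneous (d - k) := by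
  obtain ⟨α, hα, rfl⟩ := hx
  exact isHomogeneous_diffOp hα hf

theorem mul_mem_gradedPiece {i j : ℕ} {x y : A f} (hx : x ∈ gradedPiece f i)
    (hy : y ∈ gradedPiece f j) : x * y ∈ gradedPiece f (i + j) := by
  obtain ⟨α, hα, rfl⟩ := hx
  obtain ⟨β, hβ, rfl⟩ := hy
  exact ⟨α * β, hα.mul hβ, rfl⟩

theorem exists_mul_ne_zero {d i j : ℕ} (hf : f.IsHomogeneous d) {x : A f}
    (hx : x ∈ gradedPiece f i) (hx0 : x ≠ 0) (hij : i + j ≤ d) :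
    ∃ y ∈ gradedPiece f j, x * y ≠ 0 := by
  obtain ⟨β, hβ, hβx⟩ := exists_diffOp_ne_zero (k := j) (isHomogeneous_act hf hx)
    ((map_ne_zero_iff _ act_injective).mpr hx0) (by omega)
  rw [← act_mk_mul, map_ne_zero_iff _ act_injective, mul_comm] at hβx
  exact ⟨_, ⟨β, hβ, rfl⟩, hβx⟩

theorem gradedPiece_one : gradedPiece f 1 =
    Submodule.span ℂ (Set.range fun i => Ideal.Quotient.mk (Ann f) (X i)) := by
  rw [gradedPiece, homogeneousSubmodule_one_eq_span_X, Submodule.map_span, ← Set.range_comp]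
  rfl

instance [Finite σ] (k : ℕ) : Module.Finite ℂ (gradedPiece f k) :=
  Module.Finite.iff_fg.mpr ((homogeneousSubmodule_fg σ ℂ k).map _)

theorem ne_zero_of_finrank_gradedPiece_ne_zero {k : ℕ}
    (h : Module.finrank ℂ (gradedPiece f k) ≠ 0) : f ≠ 0 := by
  rintro rfl
  have : Subsingleton (A (0 : MvPolynomial σ ℂ)) := Ideal.Quotient.subsingleton_iff.mpr <|
    (Ideal.eq_top_iff_one _).mpr (map_zero (diffOp 1))
  exact h Module.finrank_zero_of_subsingleton

theorem span_range_coe_basis {R M ι : Type*} [Semiring R] [AddCommMonoid M] [Module R M]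
    {W : Submodule R M} (b : Module.Basis ι R W) :
    Submodule.span R (Set.range fun j => (b j : M)) = W := by
  rw [Set.range_comp' Subtype.val b, ← W.coe_subtype, ← Submodule.map_span, b.span_eq,
    Submodule.map_subtype_top]

theorem span_range_act_basis {κ : Type*} {k : ℕ} (b : Module.Basis κ ℂ (gradedPiece f k)) :
    Submodule.span ℂ (Set.range fun j => act f (b j : A f)) = (gradedPiece f k).map (act f) := by
  rw [Set.range_comp' (act f) fun j => (b j : A f), ← Submodule.map_span, span_range_coe_basis]

theorem span_range_diffOp_prod_X (f : MvPolynomial σ ℂ) (k : ℕ) :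
    Submodule.span ℂ (Set.range fun s : Sym σ k => diffOp ((s : Multiset σ).map X).prod f) =
      (gradedPiece f k).map (act f) := by
  rw [gradedPiece, homogeneousSubmodule_eq_span_prod_X, Submodule.map_span, Submodule.map_span,
    ← Set.range_comp, ← Set.range_comp]
  rfl

end ApolarAlgebra

section Comparison

theorem span_range_comp_congr {k K V W ι κ : Type*} [CommSemiring k] [Semiring K] [Algebra k K]
    [AddCommMonoid V] [Module k V] [AddCommMonoid W] [Module k W] [Module K W]
    [IsScalarTower k K W] (T : V →ₗ[k] W) {x : ι → V} {y : κ → V}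
    (h : Submodule.span k (Set.range x) = Submodule.span k (Set.range y)) :
    Submodule.span K (Set.range (T ∘ x)) = Submodule.span K (Set.range (T ∘ y)) := by
  rw [Set.range_comp, Set.range_comp, ← Submodule.span_span_of_tower k K (T '' Set.range x),
    ← Submodule.map_span, h, Submodule.map_span, Submodule.span_span_of_tower]

theorem jacRank_congr {σ k ι κ : Type*} [Field k] {F : ι → MvPolynomial σ k}
    {G : κ → MvPolynomial σ k}
    (h : Submodule.span k (Set.range F) = Submodule.span k (Set.range G)) :
    jacRank F = jacRank G := by
  have hspan : Submodule.span (FractionRing (MvPolynomial σ k)) (Set.range fun j => grad (F j)) =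
      Submodule.span _ (Set.range fun j => grad (G j)) := span_range_comp_congr grad.toLinearMap h
  rw [jacRank, hspan, jacRank]

variable {σ ι κ : Type*} {f : MvPolynomial σ ℂ} {d k : ℕ}

-- Up to a change of basis of `A(f)_1`, the mixed Hessian is the Jacobian matrix of the `β_j(f)`.
theorem genericRank_mixedHessian [Finite σ] [Finite ι] [Fintype κ]
    (a : Module.Basis ι ℂ (gradedPiece f 1)) (b : Module.Basis κ ℂ (gradedPiece f k)) :
    genericRank (mixedHessian f a b) = jacRank fun j => act f (b j : A f) := by
  let row : A f →ₗ[ℂ] κ → FractionRing (MvPolynomial σ ℂ) := LinearMap.pi fun j =>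
    (Algebra.linearMap _ _).restrictScalars ℂ ∘ₗ act f ∘ₗ LinearMap.mulRight ℂ (b j : A f)
  have hhess : ((mixedHessian f a b).map (algebraMap _ (FractionRing _))).row =
      row ∘ fun i => (a i : A f) := rfl
  have hjac : ((jacobian fun j => act f (b j : A f)).map (algebraMap _ (FractionRing _))).row =
      row ∘ fun l => Ideal.Quotient.mk (Ann f) (X l) := by
    ext l j
    simp [row, jacobian, act_mk_mul, diffOp_X]
  rw [← genericRank_jacobian, genericRank, genericRank, Matrix.rank_eq_finrank_span_row,
    Matrix.rank_eq_finrank_span_row, hhess, hjac, span_range_comp_congr row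
      ((span_range_coe_basis a).trans gradedPiece_one)]

theorem topologicalKrullDim_closure_ran_of_span_eq [Finite σ] [Finite ι] [Fintype κ]
    (hf : f.IsHomogeneous d) (hf0 : f ≠ 0) (hkd : k < d)
    (a : Module.Basis ι ℂ (gradedPiece f 1)) (b : Module.Basis κ ℂ (gradedPiece f k))
    {τ : Type*} [Finite τ] {F : τ → MvPolynomial σ ℂ}
    (hF : Submodule.span ℂ (Set.range F) = (gradedPiece f k).map (act f)) :
    topologicalKrullDim (closure (ratMap F).ran) + 1 =
      (genericRank (mixedHessian f a b) : WithBot ℕ∞) := by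
  rw [genericRank_mixedHessian, jacRank_congr ((span_range_act_basis b).trans hF.symm)]
  refine topologicalKrullDim_closure_ran (m := d - k) (fun j => ?_) (by omega) ?_
  · obtain ⟨x, hx, hxj⟩ := hF.le (Submodule.subset_span ⟨j, rfl⟩)
    exact hxj ▸ isHomogeneous_act hf hx
  · rintro rfl
    obtain ⟨β, hβ, hβf⟩ := exists_diffOp_ne_zero hf hf0 hkd.le
    have hβF := hF.ge ⟨_, ⟨β, hβ, rfl⟩, act_mk f β⟩
    rw [Submodule.span_eq_bot.mpr (by rintro _ ⟨j, rfl⟩; rfl), Submodule.mem_bot] at hβF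
    exact hβf hβF

end Comparison

section Multiplication

variable {σ : Type*} {f : MvPolynomial σ ℂ} {d i j k : ℕ}

theorem hasMaximalRank_mulPow_iff [Finite σ] (hf : f.IsHomogeneous d) (hij : i ≤ j)
    (hd : i + j ≤ d) (L : gradedPiece f 1) :
    HasMaximalRank (mulPow f hij L) ↔
      Module.finrank ℂ (LinearMap.range (mulPow f hij L)) =
        Module.finrank ℂ (gradedPiece f i) := by
  rw [HasMaximalRank]
  constructor
  · intro h
    rcases min_choice (Module.finrank ℂ (gradedPiece f i)) (Module.finrank ℂ (gradedPiece f j))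
      with hmin | hmin
    · rw [h, hmin]
    -- By duality, surjectivity implies injectivity.
    · have hsurj := LinearMap.range_eq_top.mp (Submodule.eq_top_of_finrank_eq (h.trans hmin))
      refine LinearMap.finrank_range_of_inj ((injective_iff_map_eq_zero _).mpr fun x hx => ?_)
      by_contra hx0
      obtain ⟨y, hy, hxy⟩ := exists_mul_ne_zero hf x.2 (Submodule.coe_eq_zero.not.mpr hx0) hd
      obtain ⟨z, hz⟩ := hsurj ⟨y, hy⟩
      have hLx : (L : A f) ^ (j - i) * x = 0 := congrArg Subtype.val hx
      have hLz : (L : A f) ^ (j - i) * z = y := congrArg Subtype.val hz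
      exact hxy (by rw [← hLz, mul_left_comm, ← mul_assoc, hLx, zero_mul])
  · intro h
    rw [h, eq_comm, min_eq_left_iff, ← h]
    exact Submodule.finrank_le _

theorem act_linForm_pow_mul [Fintype σ] {m : ℕ} (v : σ → ℂ) {x : A f}
    (hx : (act f x).IsHomogeneous m) :
    act f (Ideal.Quotient.mk (Ann f) (linForm v) ^ m * x) =
      C (m.factorial * eval v (act f x)) := by
  rw [← map_pow, act_mk_mul, diffOp_linForm_pow v hx]

theorem mulPow_eq_zero_iff [Fintype σ] (hf : f.IsHomogeneous d) (hij : i ≤ j) (hjk : j + k = d)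
    {L : gradedPiece f 1} {v : σ → ℂ} (hL : Ideal.Quotient.mk (Ann f) (linForm v) = L)
    (x : gradedPiece f i) :
    mulPow f hij L x = 0 ↔ ∀ y ∈ gradedPiece f k, eval v (act f ((x : A f) * y)) = 0 := by
  have hval : ((mulPow f hij L x : gradedPiece f j) : A f) = (L : A f) ^ (j - i) * x := rfl
  have hpair (y : A f) (hy : y ∈ gradedPiece f k) :
      (mulPow f hij L x : A f) * y = 0 ↔ eval v (act f ((x : A f) * y)) = 0 := by
    have hxy := isHomogeneous_act hf (mul_mem_gradedPiece x.2 hy)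
    rw [show d - (i + k) = j - i by omega] at hxy
    rw [hval, mul_assoc, ← hL, ← map_eq_zero_iff _ act_injective, act_linForm_pow_mul v hxy,
      C_eq_zero, mul_eq_zero, or_iff_right (Nat.cast_ne_zero.mpr (Nat.factorial_ne_zero _))]
  refine Iff.trans ?_ (forall₂_congr hpair)
  constructor
  · intro h y _
    rw [h, Submodule.coe_zero, zero_mul]
  · intro h
    by_contra h0
    obtain ⟨y, hy, hLxy⟩ :=
      exists_mul_ne_zero hf (mulPow f hij L x).2 (Submodule.coe_eq_zero.not.mpr h0) hjk.le
    exact hLxy (h y hy)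

variable {ι κ : Type*} [Finite ι] [Fintype κ]

theorem finrank_range_mulPow [Fintype σ] (hf : f.IsHomogeneous d) (hij : i ≤ j) (hjk : j + k = d)
    {L : gradedPiece f 1} {v : σ → ℂ} (hL : Ideal.Quotient.mk (Ann f) (linForm v) = L)
    (a : Module.Basis ι ℂ (gradedPiece f i)) (b : Module.Basis κ ℂ (gradedPiece f k)) :
    Module.finrank ℂ (LinearMap.range (mulPow f hij L)) =
      ((mixedHessian f a b).map (eval v)).rank := by
  let pairing : A f →ₗ[ℂ] A f →ₗ[ℂ] ℂ :=
    (LinearMap.mul ℂ (A f)).compr₂ ((aeval v).toLinearMap ∘ₗ act f)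
  let row : gradedPiece f i →ₗ[ℂ] κ → ℂ :=
    LinearMap.pi fun l => pairing.flip (b l) ∘ₗ (gradedPiece f i).subtype
  have hker : LinearMap.ker row = LinearMap.ker (mulPow f hij L) := by
    ext x
    rw [LinearMap.mem_ker, LinearMap.mem_ker, mulPow_eq_zero_iff hf hij hjk hL]
    change _ ↔ gradedPiece f k ≤ LinearMap.ker (pairing x)
    rw [← span_range_coe_basis b, Submodule.span_le, Set.range_subset_iff]
    exact funext_iff
  have hrow : ((mixedHessian f a b).map (eval v)).row = row ∘ a := rfl
  rw [Matrix.rank_eq_finrank_span_row, hrow, Set.range_comp, ← Submodule.map_span, a.span_eq,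
    ← LinearMap.range_eq_map]
  have hrank := LinearMap.finrank_range_add_finrank_ker row
  rw [hker, ← LinearMap.finrank_range_add_finrank_ker (mulPow f hij L)] at hrank
  exact (Nat.add_right_cancel hrank).symm

theorem exists_hasMaximalRank_mulPow_iff [Finite σ] (hf : f.IsHomogeneous d) (hij : i ≤ j)
    (hik : i ≤ k) (hjk : j + k = d) (a : Module.Basis ι ℂ (gradedPiece f i))
    (b : Module.Basis κ ℂ (gradedPiece f k)) :
    (∃ L, HasMaximalRank (mulPow f hij L)) ↔
      Module.finrank ℂ (gradedPiece f i) ≤ genericRank (mixedHessian f a b) := by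
  have := Fintype.ofFinite σ
  simp only [hasMaximalRank_mulPow_iff hf hij (by omega : i + j ≤ d)]
  constructor
  · rintro ⟨L, hL⟩
    obtain ⟨l, hl, hlL⟩ := L.2
    obtain ⟨v, rfl⟩ := isHomogeneous_one_iff.mp hl
    rw [← hL, finrank_range_mulPow hf hij hjk hlL a b]
    exact rank_map_eval_le_genericRank _ v
  · intro h
    obtain ⟨v, -, hv⟩ := exists_genericRank_le_rank_map_eval (mixedHessian f a b) one_ne_zero
    let L : gradedPiece f 1 := ⟨_, linForm v, isHomogeneous_one_iff.mpr ⟨v, rfl⟩, rfl⟩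
    refine ⟨L, le_antisymm (LinearMap.finrank_range_le _) (h.trans ?_)⟩
    rwa [finrank_range_mulPow hf hij hjk rfl a b]

end Multiplication

section Cone

variable {n : ℕ} {f : MvPolynomial (Fin (n + 1)) ℂ}

theorem isCone_of_dirDeriv_eq_zero {v : Fin (n + 1) → ℂ} (hv : v ≠ 0) (h : dirDeriv v f = 0) :
    IsCone f := by
  obtain ⟨y, hy, rfl⟩ := exists_linearIndependent_zero_eq (K := ℂ) (r := n) hv (by simp)
  obtain ⟨M, hM⟩ : IsUnit (Matrix.of y).transpose := by
    rw [Matrix.isUnit_transpose, ← Matrix.linearIndependent_rows_iff_isUnit]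
    exact hy
  refine ⟨M, notMem_vars_of_pderiv_eq_zero ?_⟩
  rw [hM]
  change pderiv 0 (restrictSpan y f) = 0
  rw [pderiv_restrictSpan, h, map_zero]

theorem finrank_gradedPiece_one (h : ¬ IsCone f) :
    Module.finrank ℂ (gradedPiece f 1) = n + 1 := by
  have hX : LinearIndependent ℂ fun i => Ideal.Quotient.mk (Ann f) (X i) := by
    rw [Fintype.linearIndependent_iff]
    intro c hc
    have hderiv : dirDeriv c f = 0 := by
      have := congrArg (act f) hc
      simpa only [dirDeriv_eq_sum, ← smul_eq_C_mul, map_sum, map_smul, act_mk, diffOp_X, map_zero]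
        using this
    by_contra! hne
    exact h (isCone_of_dirDeriv_eq_zero (Function.ne_iff.mpr hne) hderiv)
  rw [gradedPiece_one, finrank_span_eq_card hX, Fintype.card_fin]

end Cone

end

end HigherPolar

open HigherPolar in
/-- The number `n + 1` is that of the essential variables of `f`, which is smaller than the number
of all variables if `V(f)` is a cone. -/
theorem theorem5p2_general {σ : Type*} [Finite σ] {n d k : ℕ} (hk : 0 < k) (hkd : k < d)
    (f : MvPolynomial σ ℂ) (hf : f.IsHomogeneous d)
    (hn : Module.finrank ℂ (gradedPiece f 1) = n + 1) {ι κ : Type*} [Fintype κ]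
    (a : Module.Basis ι ℂ (gradedPiece f 1)) (b : Module.Basis κ ℂ (gradedPiece f k)) :
    topologicalKrullDim (relPolarImage f b) = topologicalKrullDim (polarImage f k) ∧
      topologicalKrullDim (relPolarImage f b) + 1
        = (genericRank (mixedHessian f a b) : WithBot ℕ∞) ∧
      List.TFAE
        [topologicalKrullDim (relPolarImage f b) < (n : WithBot ℕ∞),
          genericRank (mixedHessian f a b) < n + 1,
          ∀ L : gradedPiece f 1,
            ¬ HasMaximalRank (mulPow f (Nat.sub_pos_of_lt hkd : 1 ≤ d - k) L)] := by
  have : Finite ι := Module.Finite.finite_basis a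
  have hf0 : f ≠ 0 := ne_zero_of_finrank_gradedPiece_ne_zero (k := 1) (by omega)
  have hrel : topologicalKrullDim (relPolarImage f b) + 1 = genericRank (mixedHessian f a b) :=
    topologicalKrullDim_closure_ran_of_span_eq hf hf0 hkd a b (span_range_act_basis b)
  have hpolar : topologicalKrullDim (polarImage f k) + 1 = genericRank (mixedHessian f a b) :=
    topologicalKrullDim_closure_ran_of_span_eq hf hf0 hkd a b (span_range_diffOp_prod_X f k)
  have hlefschetz := exists_hasMaximalRank_mulPow_iff hf (Nat.sub_pos_of_lt hkd : 1 ≤ d - k) hk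
    (Nat.sub_add_cancel hkd.le) a b
  refine ⟨ENat.WithBot.add_one_cancel.mp (hrel.trans hpolar.symm), hrel, ?_⟩
  tfae_have 1 ↔ 2 := by
    rw [← ENat.WithBot.add_one_le_natCast_iff, hrel, Nat.lt_succ_iff]
    exact_mod_cast Iff.rfl
  tfae_have 2 ↔ 3 := by rw [← not_exists, hlefschetz, hn, not_le]
  tfae_finish

theorem theorem5p2 {n d k : ℕ} (hk : 0 < k) (hkd : k < d)
    (f : MvPolynomial (Fin (n + 1)) ℂ) (hf : f.IsHomogeneous d) (hcone : ¬ HigherPolar.IsCone f)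
    {ι κ : Type*} [Fintype ι] [Fintype κ]
    (a : Module.Basis ι ℂ (HigherPolar.gradedPiece f 1))
    (b : Module.Basis κ ℂ (HigherPolar.gradedPiece f k)) :
    topologicalKrullDim (HigherPolar.relPolarImage f b)
        = topologicalKrullDim (HigherPolar.polarImage f k) ∧
      topologicalKrullDim (HigherPolar.relPolarImage f b) + 1
        = (HigherPolar.genericRank (HigherPolar.mixedHessian f a b) : WithBot ℕ∞) ∧
      List.TFAE
        [topologicalKrullDim (HigherPolar.relPolarImage f b) < (n : WithBot ℕ∞),
          HigherPolar.genericRank (HigherPolar.mixedHessian f a b) < n + 1,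
          ∀ L : HigherPolar.gradedPiece f 1,
            ¬ HigherPolar.HasMaximalRank
              (HigherPolar.mulPow f (Nat.sub_pos_of_lt hkd : 1 ≤ d - k) L)] :=
  theorem5p2_general hk hkd f hf (HigherPolar.finrank_gradedPiece_one hcone) a b
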